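/- Let $V(x)=\frac{x^2}{2}+\log\sqrt{2\pi}$, so that $\mu(dx)=e^{-V(x)}\,dx$ is the standard Gaussian measure on $\mathbb{R}$. Let $\|\cdot\|$ and $\langle\cdot,\cdot\rangle$ be the norm and inner product of the real Hilbert space $L^2(\mu)$, and let $L=-D^2+V'D$, i.e. $L\varphi=-\varphi''+x\varphi'$, regarded as an unbounded operator on $L^2(\mu)$ (the closure of its restriction to the compactly supported $C^2$ functions). Let $n\ge 1$ be an integer. Then $n+L$ has a bounded everywhere defined inverse $(n+L)^{-1}$ on $L^2(\mu)$, and for every function $f:\mathbb{R}\to\mathbb{R}$ of class $C^n$ with compact support, $$\mathrm{Var}_\mu(f)=\sum_{k=1}^{n-1}\frac{(-1)^{k-1}}{k!}\,\|f^{(k)}\|^2+\frac{(-1)^{n-1}}{(n-1)!}\,\big\langle (n+L)^{-1}f^{(n)},f^{(n)}\big\rangle .$$ -/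

import Mathlib

open MeasureTheory ProbabilityTheory Real

noncomputable section

namespace OneDim

/-- The measure `μ(dx) = e^{-V(x)} dx` on the real line. -/
def gibbs (V : ℝ → ℝ) : Measure ℝ :=
  volume.withDensity fun x => ENNReal.ofReal (exp (-V x))

/-- The standard Gaussian potential: `e^{-V(x)} = (2π)^{-1/2} e^{-x²/2}`. -/
def gaussianPotential (x : ℝ) : ℝ := x ^ 2 / 2 + log √(2 * π)

/-- The differential expression `L φ = -φ'' + V' φ'`. -/
def diffOp (V φ : ℝ → ℝ) (x : ℝ) : ℝ := -deriv (deriv φ) x + deriv V x * deriv φ x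

/-- The real Hilbert space `L²(μ)`, `μ(dx) = e^{-V(x)} dx`. -/
abbrev L2 (V : ℝ → ℝ) : Type := Lp ℝ 2 (gibbs V)

lemma C2_facts {φ : ℝ → ℝ} (h : ContDiff ℝ 2 φ) :
    Differentiable ℝ φ ∧ Differentiable ℝ (deriv φ) ∧ Continuous (deriv (deriv φ)) := by
  have h1 : ContDiff ℝ 1 (deriv φ) := by
    have : ContDiff ℝ (1 + 1) φ := by simpa [one_add_one_eq_two] using h
    exact (contDiff_succ_iff_deriv.1 this).2.2
  exact ⟨h.differentiable (by norm_num), h1.differentiable (by norm_num),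
    h1.continuous_deriv (by norm_num)⟩

/-- The graph in `L²(μ) × L²(μ)` of `L = -D² + V' D` acting on the compactly supported
`C²` functions. -/
def minGraph (V : ℝ → ℝ) : Submodule ℝ (L2 V × L2 V) where
  carrier := {p | ∃ φ : ℝ → ℝ, ContDiff ℝ 2 φ ∧ HasCompactSupport φ ∧
    p.1 =ᵐ[gibbs V] φ ∧ p.2 =ᵐ[gibbs V] diffOp V φ}
  zero_mem' := by
    refine ⟨0, contDiff_const, HasCompactSupport.zero, Lp.coeFn_zero _ _ _, ?_⟩
    have : diffOp V 0 = 0 := by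
      funext x
      have h0 : deriv (0 : ℝ → ℝ) = 0 := by funext y; simp
      simp [diffOp, h0]
    rw [this]
    exact Lp.coeFn_zero _ _ _
  add_mem' := by
    rintro p q ⟨φ, hφ, cφ, h1, h2⟩ ⟨ψ, hψ, cψ, k1, k2⟩
    refine ⟨φ + ψ, hφ.add hψ, cφ.add cψ, (Lp.coeFn_add _ _).trans (h1.add k1),
      (Lp.coeFn_add _ _).trans ((h2.add k2).trans (Filter.EventuallyEq.of_eq ?_))⟩
    obtain ⟨a1, a2, -⟩ := C2_facts hφ
    obtain ⟨b1, b2, -⟩ := C2_facts hψ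
    have e : deriv (φ + ψ) = deriv φ + deriv ψ := by
      funext x; exact deriv_add (a1 x) (b1 x)
    funext x
    simp only [diffOp, Pi.add_apply, e, deriv_add (a2 x) (b2 x)]
    ring
  smul_mem' := by
    rintro c p ⟨φ, hφ, cφ, h1, h2⟩
    refine ⟨c • φ, contDiff_const.smul hφ, cφ.smul_left (f := fun _ => c),
      (Lp.coeFn_smul _ _).trans (h1.const_smul c),
      (Lp.coeFn_smul _ _).trans ((h2.const_smul c).trans (Filter.EventuallyEq.of_eq ?_))⟩
    obtain ⟨a1, a2, -⟩ := C2_facts hφ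
    have e : deriv (c • φ) = c • deriv φ := by
      funext x; exact deriv_const_smul c (a1 x)
    funext x
    simp only [diffOp, Pi.smul_apply, e, deriv_const_smul c (a2 x), smul_eq_mul]
    ring

/-- The operator `L = -D² + V' D` as an unbounded operator on `L²(μ)`: the closure of its
restriction to the compactly supported `C²` functions. -/
def L (V : ℝ → ℝ) : L2 V →ₗ.[ℝ] L2 V := (minGraph V).topologicalClosure.toLinearPMap

/-- `R` is the bounded, everywhere defined inverse `(c + T)⁻¹` of `c + T : dom T → H`. -/
structure IsShiftInverse {H : Type*} [NormedAddCommGroup H] [NormedSpace ℝ H]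
    (T : H →ₗ.[ℝ] H) (c : ℝ) (R : H →L[ℝ] H) : Prop where
  left_inv : ∀ u : T.domain, R (c • (u : H) + T u) = u
  right_inv : ∀ g : H, ∃ u : T.domain, (u : H) = R g ∧ c • (u : H) + T u = g

/-! Checks that the definitions above are the intended objects. -/

lemma gibbs_gaussianPotential : gibbs gaussianPotential = gaussianReal 0 1 := by
  rw [gaussianReal_of_var_ne_zero 0 one_ne_zero, gibbs]
  congr 1
  funext x
  rw [gaussianPDF, gaussianPDFReal, gaussianPotential, neg_add, exp_add, exp_neg (log _),
    exp_log (by positivity)]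
  simp [neg_div, mul_comm]

section Closable

variable {V : ℝ → ℝ}

lemma integral_gibbs (hV : Continuous V) (g : ℝ → ℝ) :
    ∫ x, g x ∂(gibbs V) = ∫ x, exp (-V x) * g x := by
  rw [gibbs, integral_withDensity_eq_integral_toReal_smul (by fun_prop) (by simp)]
  simp [ENNReal.toReal_ofReal (exp_pos _).le]

lemma isLocallyFinite_gibbs (hV : Continuous V) : IsLocallyFiniteMeasure (gibbs V) :=
  IsLocallyFiniteMeasure.withDensity_ofReal (by fun_prop)

lemma continuous_diffOp (hV : ContDiff ℝ 2 V) {φ : ℝ → ℝ} (hφ : ContDiff ℝ 2 φ) :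
    Continuous (diffOp V φ) := by
  obtain ⟨-, b, c⟩ := C2_facts hφ
  obtain ⟨-, b', -⟩ := C2_facts hV
  exact c.neg.add (b'.continuous.mul b.continuous)

lemma hasCompactSupport_diffOp {φ : ℝ → ℝ} (cφ : HasCompactSupport φ) :
    HasCompactSupport (diffOp V φ) :=
  (cφ.deriv.deriv.neg).add (cφ.deriv.mul_left (f := deriv V))

lemma diffOp_symm (hV : ContDiff ℝ 2 V) {φ ψ : ℝ → ℝ} (hφ : ContDiff ℝ 2 φ)
    (hψ : ContDiff ℝ 2 ψ) (cψ : HasCompactSupport ψ) :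
    ∫ x, (ψ x * diffOp V φ x - diffOp V ψ x * φ x) ∂(gibbs V) = 0 := by
  obtain ⟨a1, a2, a3⟩ := C2_facts hφ
  obtain ⟨b1, b2, b3⟩ := C2_facts hψ
  obtain ⟨v1, v2, -⟩ := C2_facts hV
  rw [integral_gibbs hV.continuous]
  have hs : HasCompactSupport fun x => exp (-V x) * (ψ x * diffOp V φ x - diffOp V ψ x * φ x) :=
    HasCompactSupport.mul_left (f := fun x => exp (-V x))
      ((cψ.mul_right (f' := diffOp V φ)).sub
        ((hasCompactSupport_diffOp (V := V) cψ).mul_right (f' := φ)))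
  have hs' : HasCompactSupport fun x => exp (-V x) * (deriv ψ x * φ x - ψ x * deriv φ x) :=
    HasCompactSupport.mul_left (f := fun x => exp (-V x))
      ((cψ.deriv.mul_right (f' := φ)).sub (cψ.mul_right (f' := deriv φ)))
  have hc := continuous_diffOp hV hφ
  have hc' := continuous_diffOp hV hψ
  have hVc := hV.continuous
  have hac := a1.continuous
  have hbc := b1.continuous
  have ha2 := a2.continuous
  have hb2 := b2.continuous
  refine integral_eq_zero_of_hasDerivAt_of_integrable
    (f := fun x => exp (-V x) * (deriv ψ x * φ x - ψ x * deriv φ x)) (fun x => ?_)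
    (Continuous.integrable_of_hasCompactSupport (by fun_prop) hs)
    (Continuous.integrable_of_hasCompactSupport (by fun_prop) hs')
  have := ((v1 x).hasDerivAt.neg.exp).mul
    ((((b2 x).hasDerivAt).mul (a1 x).hasDerivAt).sub ((b1 x).hasDerivAt.mul (a2 x).hasDerivAt))
  refine this.congr_deriv ?_
  simp only [diffOp, Pi.mul_apply, Pi.sub_apply, Pi.neg_apply]
  ring

/-- For `V` of class `C²` the operator is closable, so that `L` is the closure. -/
lemma closure_minGraph_single_valued (hV : ContDiff ℝ 2 V) :
    ∀ p ∈ (minGraph V).topologicalClosure, p.1 = 0 → p.2 = 0 := by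
  intro p hp h0
  have hfin := isLocallyFinite_gibbs hV.continuous
  have key : ∀ ψ : ℝ → ℝ, ContDiff ℝ 2 ψ → HasCompactSupport ψ →
      ∫ x, ψ x * p.2 x ∂(gibbs V) = 0 := by
    intro ψ hψ cψ
    have m1 : MemLp ψ 2 (gibbs V) := hψ.continuous.memLp_of_hasCompactSupport cψ
    have m2 : MemLp (diffOp V ψ) 2 (gibbs V) :=
      (continuous_diffOp hV hψ).memLp_of_hasCompactSupport (hasCompactSupport_diffOp cψ)
    have hcl : IsClosed {q : L2 V × L2 V |
        inner ℝ (m1.toLp ψ) q.2 - inner ℝ (m2.toLp _) q.1 = 0} :=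
      isClosed_eq (by fun_prop) continuous_const
    have hsub : (minGraph V : Set (L2 V × L2 V)) ⊆ {q : L2 V × L2 V |
        inner ℝ (m1.toLp ψ) q.2 - inner ℝ (m2.toLp _) q.1 = 0} := by
      rintro q ⟨φ, hφ, cφ, h1, h2⟩
      simp only [Set.mem_ofPred_eq]
      rw [L2.inner_def, L2.inner_def, ← integral_sub (L2.integrable_inner _ _)
        (L2.integrable_inner _ _), ← diffOp_symm hV hφ hψ cψ]
      refine integral_congr_ae ?_
      filter_upwards [h1, h2, m1.coeFn_toLp, m2.coeFn_toLp] with x e1 e2 e3 e4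
      simp [e1, e2, e3, e4, mul_comm]
    have h1 : inner ℝ (m1.toLp ψ) p.2 - inner ℝ (m2.toLp (diffOp V ψ)) p.1 = 0 :=
      closure_minimal hsub hcl hp
    rw [h0, inner_zero_right, sub_zero, L2.inner_def] at h1
    rw [← h1]
    refine integral_congr_ae ?_
    filter_upwards [m1.coeFn_toLp] with x e
    simp [e, mul_comm]
  refine (Lp.eq_zero_iff_ae_eq_zero).2 ?_
  refine ae_eq_zero_of_integral_contDiff_smul_eq_zero
    ((Lp.memLp p.2).locallyIntegrable (by norm_num)) fun ψ hψ cψ => ?_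
  exact key ψ (hψ.of_le (by norm_cast)) cψ

lemma graph_L (hV : ContDiff ℝ 2 V) : (L V).graph = (minGraph V).topologicalClosure :=
  Submodule.toLinearPMap_graph_eq _ (closure_minGraph_single_valued hV)

end Closable

lemma contDiff_gaussianPotential : ContDiff ℝ 2 gaussianPotential := by
  unfold gaussianPotential
  fun_prop

lemma diffOp_gaussianPotential (φ : ℝ → ℝ) (x : ℝ) :
    diffOp gaussianPotential φ x = -deriv (deriv φ) x + x * deriv φ x := by
  have : deriv gaussianPotential x = x := by
    have h := (((hasDerivAt_id x).pow 2).div_const 2).add_const (log √(2 * π))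
    refine (h.congr_deriv ?_).deriv
    simp
  rw [diffOp, this]

lemma graph_L_gaussian :
    (L gaussianPotential).graph = (minGraph gaussianPotential).topologicalClosure :=
  graph_L contDiff_gaussianPotential

lemma memLp_iteratedDeriv {n : ℕ} {f : ℝ → ℝ} (hf : ContDiff ℝ n f) (hc : HasCompactSupport f) :
    MemLp (iteratedDeriv n f) 2 (gibbs gaussianPotential) := by
  have hfin := isLocallyFinite_gibbs contDiff_gaussianPotential.continuous
  have hs : HasCompactSupport (iteratedDeriv n f) := by
    clear hf
    induction n with
    | zero => simpa using hc
    | succ n ih => rw [iteratedDeriv_succ]; exact ih.deriv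
  exact (hf.continuous_iteratedDeriv n le_rfl).memLp_of_hasCompactSupport hs

end OneDim

end

/-! In $L^2(\mu)$ the normalised Hermite polynomials $h_k$ form a Hilbert basis with $Lh_k=kh_k$, so
$(c+L)^{-1}$ multiplies the $k$-th coordinate by $1/(c+k)$. Differentiation is a weighted shift:
$\langle h_k,f'\rangle=\sqrt{k+1}\,\langle h_{k+1},f\rangle$. With $a_k=\langle h_k,f\rangle$ this
gives $\langle(c+1+L)^{-1}f',f'\rangle=\sum_k\frac{k}{c+k}a_k^2$. For $c=0$ the sum is
$\sum_{k\ge1}a_k^2=\mathrm{Var}_\mu(f)$, the case $n=1$. For $c>0$, writing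
$\frac{c}{c+k}=1-\frac{k}{c+k}$ gives `mul_inner_shiftInverse`, which, applied to $f^{(n)}$ with
$c=n$, turns the remainder of order $n$ into the next term of the sum and the remainder of order
$n+1$. The analytic work is completeness of the $h_k$ (`ae_eq_zero_of_integral_pow_mul_eq_zero`) and
the passage from test functions to the closure (`polynomial_mem_closure`,
`inner_hermLp_of_mem_closure`). -/

/-! ### Determinacy of the moment problem under exponential moments. -/

/-- Two finite measures on the line with finite exponential moments and the same moments are
equal. -/
lemma MeasureTheory.Measure.ext_of_moments {μ ν : Measure ℝ} [IsFiniteMeasure μ]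
    [IsFiniteMeasure ν] (hμ : integrableExpSet id μ = Set.univ)
    (hν : integrableExpSet id ν = Set.univ) (h : ∀ n : ℕ, ∫ x, x ^ n ∂μ = ∫ x, x ^ n ∂ν) :
    μ = ν := by
  have aμ : AnalyticOnNhd ℝ (mgf id μ) Set.univ := by
    simpa [hμ] using analyticOnNhd_mgf (X := id) (μ := μ)
  have aν : AnalyticOnNhd ℝ (mgf id ν) Set.univ := by
    simpa [hν] using analyticOnNhd_mgf (X := id) (μ := ν)
  have pμ := hasFPowerSeriesAt_mgf (X := id) (μ := μ) (v := 0) (by simp [hμ])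
  have pν := hasFPowerSeriesAt_mgf (X := id) (μ := ν) (v := 0) (by simp [hν])
  have hmgf : mgf id μ = mgf id ν := by
    -- The moments are the Taylor data at 0 of functions analytic on the whole line.
    refine aμ.eq_of_eventuallyEq aν (z₀ := 0) ?_
    simp only [id_eq, zero_mul, exp_zero, mul_one, h] at pμ pν
    have := pμ.sub pν
    rw [sub_self] at this
    filter_upwards [this.eventually_eq_zero] with x hx
    exact sub_eq_zero.1 hx
  have h0 : μ = 0 ↔ ν = 0 := by
    have := h 0
    simp only [pow_zero, integral_const, smul_eq_mul, mul_one] at this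
    rw [← Measure.measure_univ_eq_zero, ← measureReal_eq_zero_iff, this, measureReal_eq_zero_iff,
      Measure.measure_univ_eq_zero]
  refine Measure.ext_of_complexMGF_id_eq (funext fun z => ?_)
  exact eqOn_complexMGF_of_mgf' hmgf h0 (by simp [hμ])

/-! ### Diagonal operators and their resolvents. -/

namespace HilbertBasis

variable {ι H : Type*} [NormedAddCommGroup H] [InnerProductSpace ℝ H]

/-- Bounded multipliers of the coordinates define bounded operators. -/
lemma exists_diagonal (b : HilbertBasis ι ℝ H) {m : ι → ℝ} {C : ℝ} (hm : ∀ i, |m i| ≤ C) :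
    ∃ R : H →L[ℝ] H, ∀ x i, inner ℝ (b i) (R x) = m i * inner ℝ (b i) x := by
  have hle : ∀ (x : ι → ℝ) (i : ι), ‖m i * x i‖ ≤ ‖C * x i‖ := fun x i => by
    rw [norm_mul, norm_mul, Real.norm_eq_abs (m i)]
    exact mul_le_mul_of_nonneg_right ((hm i).trans (le_abs_self C)) (norm_nonneg _)
  have hmem : ∀ x : lp (fun _ : ι => ℝ) 2, Memℓp (fun i => m i * x i) 2 := fun x =>
    ((lp.memℓp x).const_mul C).mono' (hle x)
  let M : lp (fun _ : ι => ℝ) 2 →ₗ[ℝ] lp (fun _ : ι => ℝ) 2 :=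
    { toFun := fun x => ⟨fun i => m i * x i, hmem x⟩
      map_add' := fun x y => by ext i; exact mul_add _ _ _
      map_smul' := fun c x => by ext i; exact mul_left_comm _ _ _ }
  -- The bound is `‖C‖` because `C` may be negative when `ι` is empty.
  let M' := M.mkContinuous ‖C‖ fun x => by
    rw [← norm_smul]
    exact lp.norm_mono two_ne_zero (hle x)
  let e : H ≃L[ℝ] lp (fun _ : ι => ℝ) 2 := b.repr.toContinuousLinearEquiv
  refine ⟨(e.symm : _ →L[ℝ] H).comp (M'.comp (e : H →L[ℝ] _)), fun x i => ?_⟩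
  rw [← b.repr_apply_apply, ← b.repr_apply_apply]
  change b.repr (b.repr.symm (M (b.repr x))) i = _
  rw [LinearIsometryEquiv.apply_symm_apply]
  rfl

lemma ext_inner (b : HilbertBasis ι ℝ H) {x y : H}
    (h : ∀ i, inner ℝ (b i) x = inner ℝ (b i) y) : x = y := by
  refine b.repr.injective ?_
  ext i
  rw [b.repr_apply_apply, b.repr_apply_apply, h]

/-- A closed symmetric operator with an orthonormal basis of eigenvectors, the eigenvalues being
nonnegative, has the diagonal shift inverses. -/
lemma exists_isShiftInverse (b : HilbertBasis ι ℝ H) {T : H →ₗ.[ℝ] H} {ev : ι → ℝ}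
    (hev : ∀ i, 0 ≤ ev i) (hcl : IsClosed (T.graph : Set (H × H)))
    (hb : ∀ i, (b i, ev i • b i) ∈ T.graph)
    (hsymm : ∀ p ∈ T.graph, ∀ i, inner ℝ (b i) p.2 = ev i * inner ℝ (b i) p.1)
    {c : ℝ} (hc : 0 < c) :
    ∃ R : H →L[ℝ] H, OneDim.IsShiftInverse T c R ∧
      ∀ x i, inner ℝ (b i) (R x) = (c + ev i)⁻¹ * inner ℝ (b i) x := by
  have hpos : ∀ i, 0 < c + ev i := fun i => add_pos_of_pos_of_nonneg hc (hev i)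
  obtain ⟨R, hR⟩ := b.exists_diagonal (m := fun i => (c + ev i)⁻¹) (C := c⁻¹) fun i => by
    rw [abs_of_pos (inv_pos.2 (hpos i))]
    exact inv_anti₀ hc (le_add_of_nonneg_right (hev i))
  refine ⟨R, ⟨fun u => b.ext_inner fun i => ?_, fun g => ?_⟩, hR⟩
  · rw [hR, inner_add_right, inner_smul_right, hsymm _ (T.mem_graph u) i, ← add_mul,
      inv_mul_cancel_left₀ (hpos i).ne']
  · have h1 := b.hasSum_repr (R g)
    have h2 := b.hasSum_repr (g - c • R g)
    -- Since $1-\frac{c}{c+\lambda_i}=\frac{\lambda_i}{c+\lambda_i}$, the partial sums of both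
    -- expansions are combinations of the pairs $(b_i,\lambda_ib_i)$; closedness of the graph gives
    -- the limit.
    have hmem : (R g, g - c • R g) ∈ T.graph := by
      refine hcl.mem_of_tendsto (h1.prodMk h2) (Filter.Eventually.of_forall fun s => ?_)
      refine T.graph.sum_mem fun i _ => ?_
      convert! T.graph.smul_mem (b.repr (R g) i) (hb i) using 1
      ext1
      · rfl
      · have := (hpos i).ne'
        simp only [b.repr_apply_apply, inner_sub_right, inner_smul_right, hR, Prod.smul_snd,
          smul_smul]
        congr 1
        field_simp
        ring
    obtain ⟨u, hu, hTu⟩ := (T.mem_graph_iff).1 hmem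
    exact ⟨u, hu, by rw [hTu, hu]; exact add_sub_cancel _ _⟩

end HilbertBasis

/-! ### Gaussian integrability and integration by parts. -/

namespace OneDim

open Polynomial

local notation "γ" => gibbs gaussianPotential

instance : IsProbabilityMeasure γ := by
  rw [gibbs_gaussianPotential]
  infer_instance

lemma hasDerivAt_gaussianPotential (x : ℝ) : HasDerivAt gaussianPotential x x := by
  have h := (((hasDerivAt_id x).pow 2).div_const 2).add_const (log √(2 * π))
  exact h.congr_deriv (by simp)

lemma integrable_gibbs_iff {V : ℝ → ℝ} (hV : Continuous V) {g : ℝ → ℝ} :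
    Integrable g (gibbs V) ↔ Integrable fun x => exp (-V x) * g x := by
  rw [gibbs, integrable_withDensity_iff_integrable_smul' (by fun_prop) (by simp)]
  simp [ENNReal.toReal_ofReal (exp_pos _).le]

lemma memLp_exp_mul (t : ℝ) : MemLp (fun x => exp (t * x)) 2 γ := by
  rw [memLp_two_iff_integrable_sq (by fun_prop), gibbs_gaussianPotential]
  refine (integrable_exp_mul_gaussianReal (2 * t)).congr (ae_of_all _ fun x => ?_)
  simp only [← exp_nat_mul]
  push_cast
  ring_nf

lemma integrable_polynomial (p : ℝ[X]) : Integrable (fun x => p.eval x) γ := by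
  induction p using Polynomial.induction_on' with
  | add p q hp hq => simp only [eval_add]; exact hp.add hq
  | monomial n a =>
    simp only [eval_monomial]
    refine Integrable.const_mul ?_ a
    rw [gibbs_gaussianPotential]
    exact integrable_pow_of_mem_interior_integrableExpSet (X := id)
      (by simp [integrableExpSet_id_gaussianReal]) n

lemma memLp_polynomial (p : ℝ[X]) : MemLp (fun x => p.eval x) 2 γ := by
  rw [memLp_two_iff_integrable_sq p.continuous.aestronglyMeasurable]
  have h := integrable_polynomial (p ^ 2)
  simp only [eval_pow] at h
  exact h

lemma inner_toLp {μ : Measure ℝ} {f g : ℝ → ℝ} (hf : MemLp f 2 μ) (hg : MemLp g 2 μ) :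
    inner ℝ (hf.toLp f) (hg.toLp g) = ∫ x, f x * g x ∂μ := by
  rw [L2.inner_def]
  refine integral_congr_ae ?_
  filter_upwards [hf.coeFn_toLp, hg.coeFn_toLp] with x h1 h2
  simp [h1, h2, mul_comm]

/-- Gaussian integration by parts. -/
lemma integral_deriv_mul_polynomial {f f' : ℝ → ℝ} (hd : ∀ x, HasDerivAt f (f' x) x)
    (hf : MemLp f 2 γ) (hf' : MemLp f' 2 γ) (q : ℝ[X]) :
    ∫ x, f' x * q.eval x ∂γ = ∫ x, f x * (X * q - derivative q).eval x ∂γ := by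
  have hV := contDiff_gaussianPotential.continuous
  have i1 : Integrable (fun x => f' x * q.eval x) γ := hf'.integrable_mul (memLp_polynomial q)
  have i2 : Integrable (fun x => f x * (X * q - derivative q).eval x) γ :=
    hf.integrable_mul (memLp_polynomial _)
  have i3 : Integrable (fun x => f x * q.eval x) γ := hf.integrable_mul (memLp_polynomial q)
  rw [← sub_eq_zero, ← integral_sub i1 i2, integral_gibbs hV]
  -- The weighted difference of the integrands is the derivative of $e^{-V}fq$. Integrability of
  -- both replaces any decay assumption on $f$.
  refine integral_eq_zero_of_hasDerivAt_of_integrable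
    (f := fun x => exp (-gaussianPotential x) * (f x * q.eval x)) (fun x => ?_)
    ((integrable_gibbs_iff hV).1 (i1.sub i2)) ((integrable_gibbs_iff hV).1 i3)
  refine ((hasDerivAt_gaussianPotential x).neg.exp.mul ((hd x).mul (q.hasDerivAt x))).congr_deriv ?_
  simp only [Pi.mul_apply, Pi.neg_apply, eval_sub, eval_mul, eval_X]
  ring

/-! ### Hermite polynomials. -/

/-- The probabilists' Hermite polynomials with real coefficients. -/
noncomputable def herm : ℕ → ℝ[X]
  | 0 => 1
  | k + 1 => X * herm k - derivative (herm k)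

/-- Lowering relation, from the commutator of $D$ with the raising operator $X-D$, which is $1$. -/
lemma derivative_herm_succ (k : ℕ) : derivative (herm (k + 1)) = ((k : ℝ[X]) + 1) * herm k := by
  induction k with
  | zero => simp [herm]
  | succ k ih =>
    rw [herm, derivative_sub, derivative_mul, ih, derivative_mul]
    simp only [derivative_X, derivative_add, derivative_natCast, derivative_one]
    rw [show herm (k + 1) = X * herm k - derivative (herm k) from rfl]
    push_cast
    ring

lemma X_mul_herm_succ (k : ℕ) :
    X * herm (k + 1) = herm (k + 2) + ((k : ℝ[X]) + 1) * herm k := by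
  rw [show herm (k + 2) = X * herm (k + 1) - derivative (herm (k + 1)) from rfl,
    derivative_herm_succ]
  ring

lemma integral_deriv_mul_herm {f f' : ℝ → ℝ} (hd : ∀ x, HasDerivAt f (f' x) x)
    (hf : MemLp f 2 γ) (hf' : MemLp f' 2 γ) (k : ℕ) :
    ∫ x, f' x * (herm k).eval x ∂γ = ∫ x, f x * (herm (k + 1)).eval x ∂γ :=
  integral_deriv_mul_polynomial hd hf hf' (herm k)

lemma integral_polynomial_mul_herm_succ (p : ℝ[X]) (k : ℕ) :
    ∫ x, p.eval x * (herm (k + 1)).eval x ∂γ =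
      ∫ x, (derivative p).eval x * (herm k).eval x ∂γ :=
  (integral_deriv_mul_herm (fun x => p.hasDerivAt x) (memLp_polynomial _)
    (memLp_polynomial _) k).symm

/-- $X-D$ is the adjoint of $D$, so one integration by parts lowers both indices; the induction
stops when the derivative of the constant $1$ appears. -/
lemma integral_herm_mul_herm (j k : ℕ) :
    ∫ x, (herm j).eval x * (herm k).eval x ∂γ = if j = k then (k.factorial : ℝ) else 0 := by
  induction k generalizing j with
  | zero =>
    cases j with
    | zero => simp [herm]
    | succ j =>
      simp_rw [mul_comm (eval _ (herm (j + 1)))]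
      rw [integral_polynomial_mul_herm_succ]
      simp [herm]
  | succ k ih =>
    rw [integral_polynomial_mul_herm_succ]
    cases j with
    | zero => simp [herm]
    | succ j =>
      simp only [derivative_herm_succ, eval_mul, eval_add, eval_natCast, eval_one, mul_assoc]
      rw [integral_const_mul, ih]
      by_cases h : j = k
      · simp [h, Nat.factorial_succ]
      · simp [h]

/-- The span contains $1$ and, by the three-term recurrence, is stable under multiplication by $X$.
-/
lemma span_range_herm : Submodule.span ℝ (Set.range herm) = ⊤ := by
  have hX : ∀ p ∈ Submodule.span ℝ (Set.range herm), X * p ∈ Submodule.span ℝ (Set.range herm) := by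
    intro p hp
    induction hp using Submodule.span_induction with
    | mem p hp =>
      obtain ⟨k, rfl⟩ := hp
      cases k with
      | zero => exact Submodule.subset_span ⟨1, by simp [herm]⟩
      | succ k =>
        rw [X_mul_herm_succ]
        refine Submodule.add_mem _ (Submodule.subset_span ⟨_, rfl⟩) ?_
        have : ((k : ℝ[X]) + 1) * herm k = ((k : ℝ) + 1) • herm k := by
          rw [smul_eq_C_mul]; simp
        rw [this]
        exact Submodule.smul_mem _ _ (Submodule.subset_span ⟨_, rfl⟩)
    | zero => simp
    | add p q _ _ hp hq => rw [mul_add]; exact Submodule.add_mem _ hp hq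
    | smul c p _ hp => rw [mul_smul_comm]; exact Submodule.smul_mem _ c hp
  rw [eq_top_iff]
  rintro p -
  induction p using Polynomial.induction_on with
  | C a =>
    rw [← mul_one (C a), ← smul_eq_C_mul]
    exact Submodule.smul_mem _ _ (Submodule.subset_span ⟨0, rfl⟩)
  | add p q hp hq => exact Submodule.add_mem _ hp hq
  | monomial n a ih =>
    rw [pow_succ', mul_left_comm]
    exact hX _ ih

/-! ### Completeness and the Hermite basis. -/

/-- A square integrable function which is orthogonal to all polynomials vanishes. -/
lemma ae_eq_zero_of_integral_pow_mul_eq_zero {g : ℝ → ℝ} (hg : MemLp g 2 γ)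
    (h : ∀ n : ℕ, ∫ x, x ^ n * g x ∂γ = 0) : g =ᵐ[γ] 0 := by
  -- `ENNReal.ofReal` truncates at zero, so $u=g$ and $u=-g$ give the measures with densities $g^+$
  -- and $g^-$. Exponentials are in $L^2(\mu)$, hence both have all exponential moments, and the
  -- hypothesis says that their moments agree.
  have key : ∀ u : ℝ → ℝ, MemLp u 2 γ →
      IsFiniteMeasure ((γ).withDensity fun x => ENNReal.ofReal (u x)) ∧
      integrableExpSet id ((γ).withDensity fun x => ENNReal.ofReal (u x)) = Set.univ ∧
      ∀ n : ℕ, ∫ x, x ^ n ∂((γ).withDensity fun x => ENNReal.ofReal (u x)) =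
        ∫ x, x ^ n * max (u x) 0 ∂γ := by
    intro u hu
    have hm : AEMeasurable (fun x => ENNReal.ofReal (u x)) γ := hu.1.aemeasurable.ennreal_ofReal
    have hup : MemLp (fun x => max (u x) 0) 2 γ := hu.pos_part
    refine ⟨isFiniteMeasure_withDensity_ofReal (hu.integrable (by norm_num)).2, ?_, fun n => ?_⟩
    · refine Set.eq_univ_of_forall fun t => ?_
      change Integrable _ _
      rw [integrable_withDensity_iff_integrable_smul₀' hm (by simp)]
      exact hup.integrable_mul (memLp_exp_mul t)
    · rw [integral_withDensity_eq_integral_toReal_smul₀ hm (by simp)]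
      exact integral_congr_ae (ae_of_all _ fun x => mul_comm _ _)
  obtain ⟨f1, e1, m1⟩ := key g hg
  obtain ⟨f2, e2, m2⟩ := key (-g) hg.neg
  have hpow : ∀ n : ℕ, MemLp (fun x : ℝ => x ^ n) 2 γ := fun n => by
    simpa using memLp_polynomial (X ^ n)
  have heq := Measure.ext_of_moments e1 e2 fun n => by
    have i1 : Integrable (fun x => x ^ n * max (g x) 0) γ := (hpow n).integrable_mul hg.pos_part
    have i2 : Integrable (fun x => x ^ n * max ((-g) x) 0) γ :=
      (hpow n).integrable_mul hg.neg.pos_part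
    rw [m1, m2, ← sub_eq_zero, ← integral_sub i1 i2]
    refine Eq.trans ?_ (h n)
    refine integral_congr_ae (ae_of_all _ fun x => ?_)
    have := posPart_sub_negPart (g x)
    simp only [posPart_def, negPart_def] at this
    simp only [Pi.neg_apply, ← mul_sub]
    rw [this]
  rw [withDensity_eq_iff_of_sigmaFinite hg.1.aemeasurable.ennreal_ofReal
    hg.neg.1.aemeasurable.ennreal_ofReal] at heq
  filter_upwards [heq] with x hx
  simp only [Pi.neg_apply] at hx
  rcases le_total (g x) 0 with h0 | h0
  · rw [ENNReal.ofReal_of_nonpos h0, eq_comm, ENNReal.ofReal_eq_zero] at hx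
    simp only [Pi.zero_apply]; linarith
  · rw [ENNReal.ofReal_of_nonpos (neg_nonpos.2 h0), ENNReal.ofReal_eq_zero] at hx
    simp only [Pi.zero_apply]; linarith

/-- The Hermite polynomials as elements of the Gaussian `L²` space. -/
noncomputable def hermLp (k : ℕ) : L2 gaussianPotential :=
  (memLp_polynomial (herm k)).toLp _

/-- The normalised Hermite polynomials. -/
noncomputable def hermUnit (k : ℕ) : L2 gaussianPotential :=
  (√(k.factorial : ℝ))⁻¹ • hermLp k

lemma inner_hermLp {g : ℝ → ℝ} (hg : MemLp g 2 γ) (k : ℕ) :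
    inner ℝ (hermLp k) (hg.toLp g) = ∫ x, g x * (herm k).eval x ∂γ := by
  rw [hermLp, inner_toLp]
  simp_rw [mul_comm]

lemma orthonormal_hermUnit : Orthonormal ℝ hermUnit := by
  rw [orthonormal_iff_ite]
  intro j k
  rw [hermUnit, hermUnit, inner_smul_left, inner_smul_right, hermLp, hermLp, inner_toLp,
    integral_herm_mul_herm]
  split_ifs with h
  · subst h
    have := Real.sq_sqrt (Nat.cast_nonneg (α := ℝ) j.factorial)
    have h0 : √(j.factorial : ℝ) ≠ 0 := by positivity
    simp only [conj_trivial]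
    field_simp
    exact this.symm
  · simp

lemma integral_polynomial_mul_eq_zero {g : ℝ → ℝ} (hg : MemLp g 2 γ)
    (h : ∀ k, ∫ x, (herm k).eval x * g x ∂γ = 0) (p : ℝ[X]) : ∫ x, p.eval x * g x ∂γ = 0 := by
  have hp : p ∈ Submodule.span ℝ (Set.range herm) := by simp [span_range_herm]
  induction hp using Submodule.span_induction with
  | mem p hp =>
    obtain ⟨k, rfl⟩ := hp
    exact h k
  | zero => simp
  | add p q _ _ hp hq =>
    simp only [eval_add, add_mul]
    have i : ∀ r : ℝ[X], Integrable (fun x => r.eval x * g x) γ := fun r =>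
      (memLp_polynomial r).integrable_mul hg
    rw [integral_add (i p) (i q), hp, hq, add_zero]
  | smul c p _ hp =>
    simp only [eval_smul, smul_eq_mul, mul_assoc]
    rw [integral_const_mul, hp, mul_zero]

lemma span_hermUnit_orthogonal : (Submodule.span ℝ (Set.range hermUnit))ᗮ = ⊥ := by
  rw [Submodule.eq_bot_iff]
  intro g hg
  refine Lp.eq_zero_iff_ae_eq_zero.2 (ae_eq_zero_of_integral_pow_mul_eq_zero (Lp.memLp g) ?_)
  intro n
  suffices h : ∀ k, ∫ x, (herm k).eval x * g x ∂γ = 0 by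
    simpa using integral_polynomial_mul_eq_zero (Lp.memLp g) h (X ^ n)
  intro k
  have h := (Submodule.mem_orthogonal _ _).1 hg _ (Submodule.subset_span ⟨k, rfl⟩)
  rw [hermUnit, inner_smul_left] at h
  have h0 : √(k.factorial : ℝ) ≠ 0 := by positivity
  have h1 : inner ℝ (hermLp k) g = 0 := by simpa [Nat.factorial_ne_zero] using h
  rw [← Lp.toLp_coeFn g (Lp.memLp g), inner_hermLp] at h1
  simpa only [mul_comm] using h1

/-- The Hermite basis of the Gaussian `L²` space. -/
noncomputable def hermBasis : HilbertBasis ℕ ℝ (L2 gaussianPotential) :=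
  HilbertBasis.mkOfOrthogonalEqBot orthonormal_hermUnit span_hermUnit_orthogonal

lemma hermBasis_apply (k : ℕ) : hermBasis k = (√(k.factorial : ℝ))⁻¹ • hermLp k := by
  rw [hermBasis, HilbertBasis.coe_mkOfOrthogonalEqBot, hermUnit]

/-! ### Hermite polynomials as eigenvectors of the closed operator. -/

open Filter Topology

lemma tendsto_toLp_of_dominated {μ : Measure ℝ} {F : ℕ → ℝ → ℝ} {f G : ℝ → ℝ}
    (hF : ∀ n, MemLp (F n) 2 μ) (hf : MemLp f 2 μ) (hG : MemLp G 2 μ)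
    (hle : ∀ n x, |F n x| ≤ G x) (hlim : ∀ x, Tendsto (fun n => F n x) atTop (𝓝 (f x))) :
    Tendsto (fun n => (hF n).toLp (F n)) atTop (𝓝 (hf.toLp f)) := by
  rw [tendsto_iff_norm_sub_tendsto_zero]
  have hsq : Tendsto (fun n => ‖(hF n).toLp (F n) - hf.toLp f‖ ^ 2) atTop (𝓝 0) := by
    have e : ∀ n, ‖(hF n).toLp (F n) - hf.toLp f‖ ^ 2 = ∫ x, (F n x - f x) ^ 2 ∂μ := fun n => by
      rw [← MemLp.toLp_sub, ← real_inner_self_eq_norm_sq, inner_toLp]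
      simp only [Pi.sub_apply, sq]
    simp_rw [e]
    rw [← integral_zero ℝ ℝ (μ := μ)]
    refine tendsto_integral_of_dominated_convergence (fun x => (2 * G x) ^ 2)
      (fun n => (((hF n).sub hf).1.pow 2)) ?_ (fun n => ae_of_all _ fun x => ?_)
      (ae_of_all _ fun x => ?_)
    · exact (memLp_two_iff_integrable_sq (hG.const_mul 2).1).1 (hG.const_mul 2)
    · have h1 := abs_le.1 (hle n x)
      have h2 := abs_le.1 (le_of_tendsto' (hlim x).abs fun n => hle n x)
      rw [norm_pow, Real.norm_eq_abs]
      exact pow_le_pow_left₀ (abs_nonneg _) (abs_le.2 ⟨by linarith, by linarith⟩) 2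
    · have := ((hlim x).sub_const (f x)).pow 2
      simpa using this
  have := hsq.sqrt
  simpa using this

lemma contDiff_polynomial (p : ℝ[X]) : ContDiff ℝ 2 fun x => p.eval x := by
  simpa using p.contDiff_aeval (𝕜 := ℝ) 2

/-- Polynomials belong to the domain of the closure of `L`, which acts on them as the differential
expression. -/
lemma polynomial_mem_closure (p : ℝ[X]) :
    ((memLp_polynomial p).toLp _,
      (memLp_polynomial (X * derivative p - derivative (derivative p))).toLp _) ∈
      (minGraph gaussianPotential).topologicalClosure := by
  -- Approximation by $\chi(sx)p(x)$ with $s\to0$: every derivative falling on the cutoff brings a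
  -- factor $s$, so the extra terms vanish in the limit, and for $s\le1$ all terms are dominated by
  -- fixed multiples of polynomials.
  let χ : ContDiffBump (0 : ℝ) := ⟨1, 2, one_pos, one_lt_two⟩
  have hχ : ContDiff ℝ 2 χ := χ.contDiff
  have cχ : HasCompactSupport χ := χ.hasCompactSupport
  have χ0 : χ 0 = 1 := χ.one_of_mem_closedBall (by simp [χ])
  obtain ⟨d1, d2, c3⟩ := C2_facts hχ
  have c1 := d1.continuous
  have c2 := d2.continuous
  obtain ⟨C0, hC0⟩ := cχ.exists_bound_of_continuous c1
  obtain ⟨C1, hC1⟩ := cχ.deriv.exists_bound_of_continuous c2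
  obtain ⟨C2, hC2⟩ := cχ.deriv.deriv.exists_bound_of_continuous c3
  simp only [Real.norm_eq_abs] at hC0 hC1 hC2
  set q : ℝ[X] := X * derivative p - derivative (derivative p) with hq
  let ε : ℕ → ℝ := fun n => 1 / ((n : ℝ) + 1)
  have ε0 : ∀ n, 0 < ε n := fun n => Nat.one_div_pos_of_nat
  have ε1 : ∀ n, ε n ≤ 1 := fun n => by
    rw [div_le_one (by positivity)]
    linarith [Nat.cast_nonneg (α := ℝ) n]
  have εlim : Tendsto ε atTop (𝓝 0) := tendsto_one_div_add_atTop_nhds_zero_nat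
  let φ : ℝ → ℝ → ℝ := fun s x => χ (s * x) * p.eval x
  let F : ℝ → ℝ → ℝ := fun s x => χ (s * x) * q.eval x
    - 2 * (s * deriv χ (s * x)) * (derivative p).eval x
    - s ^ 2 * deriv (deriv χ) (s * x) * p.eval x
    + (s * deriv χ (s * x)) * (X * p).eval x
  have hφ : ∀ s, ContDiff ℝ 2 (φ s) := fun s =>
    (hχ.comp (contDiff_const.mul contDiff_id)).mul (contDiff_polynomial p)
  have cφ : ∀ s, s ≠ 0 → HasCompactSupport (φ s) := fun s hs => by
    have : HasCompactSupport fun x => χ (s * x) := by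
      simpa [smul_eq_mul] using cχ.comp_smul hs
    exact this.mul_right
  have ds : ∀ s x : ℝ, HasDerivAt (fun x => s * x) s x := fun s x => by
    simpa using (hasDerivAt_id x).const_mul s
  have D1 : ∀ s x, HasDerivAt (φ s)
      (deriv χ (s * x) * s * p.eval x + χ (s * x) * (derivative p).eval x) x := fun s x =>
    ((d1 _).hasDerivAt.comp x (ds s x)).mul (p.hasDerivAt x)
  have D2 : ∀ s x, HasDerivAt (deriv (φ s))
      ((deriv (deriv χ) (s * x) * s * s * p.eval x
        + deriv χ (s * x) * s * (derivative p).eval x)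
        + (deriv χ (s * x) * s * (derivative p).eval x
        + χ (s * x) * (derivative (derivative p)).eval x)) x := fun s x => by
    rw [funext fun y => (D1 s y).deriv]
    exact ((((d2 _).hasDerivAt.comp x (ds s x)).mul_const s).mul (p.hasDerivAt x)).add
      (((d1 _).hasDerivAt.comp x (ds s x)).mul ((derivative p).hasDerivAt x))
  have hF : ∀ s, diffOp gaussianPotential (φ s) = F s := fun s => by
    funext x
    rw [diffOp_gaussianPotential, (D2 s x).deriv, (D1 s x).deriv]
    simp only [F, hq, eval_sub, eval_mul, eval_X]
    ring
  have hfin := isLocallyFinite_gibbs contDiff_gaussianPotential.continuous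
  have mφ : ∀ n, MemLp (φ (ε n)) 2 γ := fun n =>
    (hφ _).continuous.memLp_of_hasCompactSupport (cφ _ (ε0 n).ne')
  have mF : ∀ n, MemLp (F (ε n)) 2 γ := fun n => by
    rw [← hF]
    exact (continuous_diffOp contDiff_gaussianPotential (hφ _)).memLp_of_hasCompactSupport
      (hasCompactSupport_diffOp (cφ _ (ε0 n).ne'))
  have l1 : Tendsto (fun n => (mφ n).toLp _) atTop (𝓝 ((memLp_polynomial p).toLp _)) := by
    refine tendsto_toLp_of_dominated mφ _ ((memLp_polynomial p).abs.const_mul C0)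
      (fun n x => ?_) fun x => ?_
    · rw [abs_mul]
      exact mul_le_mul_of_nonneg_right (hC0 _) (abs_nonneg _)
    · have : Continuous fun s => φ s x := by fun_prop
      have h := (this.tendsto 0).comp εlim
      have h0 : φ 0 x = p.eval x := by simp [φ, χ0]
      rwa [h0] at h
  have l2 : Tendsto (fun n => (mF n).toLp _) atTop (𝓝 ((memLp_polynomial q).toLp _)) := by
    refine tendsto_toLp_of_dominated mF _
      (((((memLp_polynomial q).abs.const_mul C0).add
        ((memLp_polynomial (derivative p)).abs.const_mul (2 * C1))).add
        ((memLp_polynomial p).abs.const_mul C2)).add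
        ((memLp_polynomial (X * p)).abs.const_mul C1))
      (fun n x => ?_) fun x => ?_
    · have e1 : |ε n * deriv χ (ε n * x)| ≤ C1 := by
        rw [abs_mul, abs_of_pos (ε0 n)]
        exact (mul_le_of_le_one_left (abs_nonneg _) (ε1 n)).trans (hC1 _)
      have e2 : |ε n ^ 2 * deriv (deriv χ) (ε n * x)| ≤ C2 := by
        rw [abs_mul, abs_of_pos (pow_pos (ε0 n) 2)]
        exact (mul_le_of_le_one_left (abs_nonneg _)
          (pow_le_one₀ (ε0 n).le (ε1 n))).trans (hC2 _)
      refine (abs_add_le _ _).trans (add_le_add ((abs_sub _ _).trans (add_le_add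
        ((abs_sub _ _).trans (add_le_add ?_ ?_)) ?_)) ?_) <;> rw [abs_mul]
      · exact mul_le_mul_of_nonneg_right (hC0 _) (abs_nonneg _)
      · refine mul_le_mul_of_nonneg_right ?_ (abs_nonneg _)
        rw [abs_mul, abs_two]
        linarith
      · exact mul_le_mul_of_nonneg_right e2 (abs_nonneg _)
      · exact mul_le_mul_of_nonneg_right e1 (abs_nonneg _)
    · have : Continuous fun s => F s x := by fun_prop
      have h := (this.tendsto 0).comp εlim
      have h0 : F 0 x = q.eval x := by simp [F, χ0]
      rwa [h0] at h
  refine mem_closure_of_tendsto (l1.prodMk_nhds l2) (Eventually.of_forall fun n => ?_)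
  refine ⟨φ (ε n), hφ _, cφ _ (ε0 n).ne', (mφ n).coeFn_toLp, ?_⟩
  rw [hF]
  exact (mF n).coeFn_toLp

/-- By the lowering relation the left side at index $k+1$ is $(k+1)(X-D)$ applied to `herm k`. -/
lemma X_mul_derivative_sub_herm (k : ℕ) :
    X * derivative (herm k) - derivative (derivative (herm k)) = (k : ℝ[X]) * herm k := by
  cases k with
  | zero => simp [herm]
  | succ k =>
    rw [derivative_herm_succ, derivative_mul,
      show herm (k + 1) = X * herm k - derivative (herm k) from rfl]
    simp
    ring

lemma hermLp_mem_closure (k : ℕ) :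
    (hermLp k, (k : ℝ) • hermLp k) ∈ (minGraph gaussianPotential).topologicalClosure := by
  convert! polynomial_mem_closure (herm k) using 2
  rw [hermLp, ← MemLp.toLp_const_smul]
  congr 1
  funext x
  rw [X_mul_derivative_sub_herm]
  simp

/-- The condition is closed, so test functions suffice; there it is symmetry of $L$, and
`diffOp_symm` needs compact support of only one of the two functions. -/
lemma inner_hermLp_of_mem_closure {p : L2 gaussianPotential × L2 gaussianPotential}
    (hp : p ∈ (minGraph gaussianPotential).topologicalClosure) (k : ℕ) :
    inner ℝ (hermLp k) p.2 = k * inner ℝ (hermLp k) p.1 := by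
  have hcl : IsClosed {q : L2 gaussianPotential × L2 gaussianPotential |
      inner ℝ (hermLp k) q.2 = k * inner ℝ (hermLp k) q.1} :=
    isClosed_eq (by fun_prop) (by fun_prop)
  refine closure_minimal ?_ hcl hp
  rintro ⟨u, v⟩ ⟨φ, hφ, cφ, h1, h2⟩
  have hfin := isLocallyFinite_gibbs contDiff_gaussianPotential.continuous
  have m1 : MemLp φ 2 γ := hφ.continuous.memLp_of_hasCompactSupport cφ
  have m2 : MemLp (diffOp gaussianPotential φ) 2 γ :=
    (continuous_diffOp contDiff_gaussianPotential hφ).memLp_of_hasCompactSupport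
      (hasCompactSupport_diffOp cφ)
  have e1 : u = m1.toLp φ := Lp.ext (h1.trans m1.coeFn_toLp.symm)
  have e2 : v = m2.toLp _ := Lp.ext (h2.trans m2.coeFn_toLp.symm)
  have hL : ∀ x, diffOp gaussianPotential (fun x => (herm k).eval x) x =
      k * (herm k).eval x := fun x => by
    have := congrArg (eval x) (X_mul_derivative_sub_herm k)
    simp only [eval_sub, eval_mul, eval_X, eval_natCast] at this
    rw [← this, diffOp_gaussianPotential]
    have hd : deriv (fun x => (herm k).eval x) = fun x => (derivative (herm k)).eval x :=
      funext fun y => ((herm k).hasDerivAt y).deriv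
    rw [hd, Polynomial.deriv]
    ring
  have key := diffOp_symm contDiff_gaussianPotential (φ := fun x => (herm k).eval x)
    (contDiff_polynomial _) hφ cφ
  have i1 : Integrable (fun x => diffOp gaussianPotential φ x * (herm k).eval x) γ :=
    m2.integrable_mul (memLp_polynomial _)
  have i2 : Integrable (fun x => φ x * (herm k).eval x) γ :=
    m1.integrable_mul (memLp_polynomial _)
  simp only [Set.mem_ofPred_eq]
  rw [e1, e2, inner_hermLp, inner_hermLp, eq_comm, ← sub_eq_zero, ← integral_const_mul,
    ← integral_sub (i2.const_mul _) i1, ← key]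
  refine integral_congr_ae (ae_of_all _ fun x => ?_)
  simp only [hL]
  ring

lemma exists_isShiftInverse_L {c : ℝ} (hc : 0 < c) :
    ∃ R : L2 gaussianPotential →L[ℝ] L2 gaussianPotential,
      IsShiftInverse (L gaussianPotential) c R ∧
      ∀ x k, inner ℝ (hermBasis k) (R x) = (c + k)⁻¹ * inner ℝ (hermBasis k) x := by
  refine hermBasis.exists_isShiftInverse (ev := fun k => (k : ℝ)) (fun k => Nat.cast_nonneg k)
    ?_ (fun k => ?_) (fun p hp k => ?_) hc
  · rw [graph_L_gaussian]
    exact Submodule.isClosed_topologicalClosure _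
  · rw [graph_L_gaussian, hermBasis_apply, smul_comm]
    exact Submodule.smul_mem _ _ (hermLp_mem_closure k)
  · rw [graph_L_gaussian] at hp
    rw [hermBasis_apply, inner_smul_left, inner_smul_left, inner_hermLp_of_mem_closure hp]
    ring

/-! ### Derivatives and resolvents in Hermite coordinates. -/

lemma inner_hermBasis_deriv {f f' : ℝ → ℝ} (hd : ∀ x, HasDerivAt f (f' x) x)
    (hf : MemLp f 2 γ) (hf' : MemLp f' 2 γ) (k : ℕ) :
    inner ℝ (hermBasis k) (hf'.toLp f') = √(k + 1) * inner ℝ (hermBasis (k + 1)) (hf.toLp f) := by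
  rw [hermBasis_apply, hermBasis_apply, inner_smul_left, inner_smul_left, inner_hermLp,
    inner_hermLp, integral_deriv_mul_herm hd hf hf', Nat.factorial_succ, Nat.cast_mul,
    Real.sqrt_mul (by positivity)]
  have h1 : √((k : ℝ) + 1) ≠ 0 := by positivity
  have h2 : √(k.factorial : ℝ) ≠ 0 := by positivity
  simp only [conj_trivial, Nat.cast_add, Nat.cast_one]
  field_simp

lemma hasSum_sq_inner_hermBasis (x : L2 gaussianPotential) :
    HasSum (fun k => (inner ℝ (hermBasis k) x) ^ 2) (‖x‖ ^ 2) := by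
  rw [← real_inner_self_eq_norm_sq]
  convert! hermBasis.hasSum_inner_mul_inner x x using 2 with k
  rw [real_inner_comm (hermBasis k) x, sq]

variable {R : L2 gaussianPotential →L[ℝ] L2 gaussianPotential} {c : ℝ}

lemma hasSum_inner_diagonal
    (hR : ∀ x k, inner ℝ (hermBasis k) (R x) = (c + k)⁻¹ * inner ℝ (hermBasis k) x)
    (x : L2 gaussianPotential) :
    HasSum (fun k : ℕ => (c + k)⁻¹ * (inner ℝ (hermBasis k) x) ^ 2) (inner ℝ (R x) x) := by
  convert! hermBasis.hasSum_inner_mul_inner (R x) x using 2 with k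
  rw [real_inner_comm (hermBasis k) (R x), hR]
  ring

/-- The index shift caused by differentiation absorbs the $1$ in $c+1+k$ and leaves the weight $k$,
which kills the constant mode. No sign of $c$ is assumed, so $c=0$ is available for the variance. -/
lemma hasSum_inner_diagonal_deriv {f f' : ℝ → ℝ} (hd : ∀ x, HasDerivAt f (f' x) x)
    (hf : MemLp f 2 γ) (hf' : MemLp f' 2 γ)
    (hR : ∀ x k, inner ℝ (hermBasis k) (R x) = (c + 1 + k)⁻¹ * inner ℝ (hermBasis k) x) :
    HasSum (fun k : ℕ => k * (c + k)⁻¹ * (inner ℝ (hermBasis k) (hf.toLp f)) ^ 2)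
      (inner ℝ (R (hf'.toLp f')) (hf'.toLp f')) := by
  rw [← hasSum_nat_add_iff' 1]
  simp only [Finset.range_one, Finset.sum_singleton, Nat.cast_zero, zero_mul, sub_zero]
  convert! hasSum_inner_diagonal hR (hf'.toLp f') using 2 with k
  rw [inner_hermBasis_deriv hd hf hf', mul_pow, Real.sq_sqrt (by positivity)]
  push_cast
  rw [show c + ((k : ℝ) + 1) = c + 1 + k by ring]
  ring

/-- `c ⟨(c + L)⁻¹ f, f⟩ = ‖f‖² - ⟨(c + 1 + L)⁻¹ f', f'⟩`. -/
lemma mul_inner_shiftInverse {f f' : ℝ → ℝ} (hd : ∀ x, HasDerivAt f (f' x) x)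
    (hf : MemLp f 2 γ) (hf' : MemLp f' 2 γ) (hc : 0 < c)
    {R' : L2 gaussianPotential →L[ℝ] L2 gaussianPotential}
    (hR : ∀ x k, inner ℝ (hermBasis k) (R x) = (c + k)⁻¹ * inner ℝ (hermBasis k) x)
    (hR' : ∀ x k, inner ℝ (hermBasis k) (R' x) = (c + 1 + k)⁻¹ * inner ℝ (hermBasis k) x) :
    c * inner ℝ (R (hf.toLp f)) (hf.toLp f) =
      ∫ x, f x ^ 2 ∂γ - inner ℝ (R' (hf'.toLp f')) (hf'.toLp f') := by
  have h1 := (hasSum_inner_diagonal hR (hf.toLp f)).mul_left c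
  have h2 := (hasSum_sq_inner_hermBasis (hf.toLp f)).sub
    (hasSum_inner_diagonal_deriv hd hf hf' hR')
  rw [← real_inner_self_eq_norm_sq, inner_toLp] at h2
  simp only [← sq] at h2
  -- Termwise this is $\frac{c}{c+k}=1-\frac{k}{c+k}$.
  refine h1.unique (h2.congr_fun ?_)
  intro k
  have : c + (k : ℝ) ≠ 0 := by positivity
  field_simp
  ring

/-- `Var f = ⟨(1 + L)⁻¹ f', f'⟩`. -/
lemma variance_eq_inner_shiftInverse {f f' : ℝ → ℝ} (hd : ∀ x, HasDerivAt f (f' x) x)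
    (hf : MemLp f 2 γ) (hf' : MemLp f' 2 γ)
    (hR : ∀ x k, inner ℝ (hermBasis k) (R x) = (1 + (k : ℝ))⁻¹ * inner ℝ (hermBasis k) x) :
    variance f γ = inner ℝ (R (hf'.toLp f')) (hf'.toLp f') := by
  have h1 := hasSum_inner_diagonal_deriv (c := 0) hd hf hf' (by simpa using hR)
  have h2 := hasSum_sq_inner_hermBasis (hf.toLp f)
  -- Dropping index 0 removes the squared mean from $\|f\|^2$; at the other indices the multiplier
  -- $k\cdot k^{-1}$ is $1$.
  rw [← hasSum_nat_add_iff' 1] at h1 h2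
  have h0 : inner ℝ (hermBasis 0) (hf.toLp f) = ∫ x, f x ∂γ := by
    rw [hermBasis_apply, inner_smul_left, inner_hermLp]
    simp [herm]
  rw [← real_inner_self_eq_norm_sq, inner_toLp] at h2
  simp only [Finset.range_one, Finset.sum_singleton, Nat.cast_zero, zero_mul, sub_zero, h0,
    zero_add, ← sq] at h1 h2
  rw [variance_eq_sub hf]
  refine h2.unique (h1.congr_fun fun k => ?_)
  have : ((k + 1 : ℕ) : ℝ) ≠ 0 := by positivity
  rw [mul_inv_cancel₀ this, one_mul]

end OneDim

/-! ### The variance expansion, by induction on the order. -/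

theorem mainTheorem3 (n : ℕ) (hn : 1 ≤ n) :
    ∃ R : OneDim.L2 OneDim.gaussianPotential →L[ℝ] OneDim.L2 OneDim.gaussianPotential,
      OneDim.IsShiftInverse (OneDim.L OneDim.gaussianPotential) (n : ℝ) R ∧
      ∀ (f : ℝ → ℝ) (hf : ContDiff ℝ n f) (hc : HasCompactSupport f),
        ProbabilityTheory.variance f (OneDim.gibbs OneDim.gaussianPotential) =
          ∑ k ∈ Finset.Icc 1 (n - 1), (-1 : ℝ) ^ (k - 1) / (Nat.factorial k : ℝ) *
              ∫ x, (iteratedDeriv k f x) ^ 2 ∂(OneDim.gibbs OneDim.gaussianPotential)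
            + (-1 : ℝ) ^ (n - 1) / (Nat.factorial (n - 1) : ℝ) *
              inner ℝ
                (R ((OneDim.memLp_iteratedDeriv hf hc).toLp (iteratedDeriv n f)))
                ((OneDim.memLp_iteratedDeriv hf hc).toLp (iteratedDeriv n f)) := by
  -- `R m` inverts $m+1+L$. The whole family is fixed before the induction, since each step relates
  -- two consecutive resolvents.
  choose R hinv hR using fun m : ℕ => OneDim.exists_isShiftInverse_L (c := (m : ℝ) + 1)
    (by positivity)
  obtain ⟨m, rfl⟩ := Nat.exists_eq_add_of_le' hn
  clear hn
  refine ⟨R m, by simpa using hinv m, ?_⟩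
  induction m with
  | zero =>
    intro f hf hc
    have hf1 : ContDiff ℝ 1 f := by simpa using hf
    have hd : ∀ x, HasDerivAt f (iteratedDeriv 1 f x) x := fun x => by
      rw [iteratedDeriv_one]
      exact (hf1.differentiable one_ne_zero x).hasDerivAt
    have h0 := OneDim.memLp_iteratedDeriv (n := 0) (hf.of_le (by simp)) hc
    rw [iteratedDeriv_zero] at h0
    simpa using OneDim.variance_eq_inner_shiftInverse hd h0 (OneDim.memLp_iteratedDeriv hf hc)
      (R := R 0) (by simpa using hR 0)
  | succ m ih =>
    intro f hf hc
    have hf' : ContDiff ℝ (m + 1 : ℕ) f := hf.of_le (by exact_mod_cast Nat.le_succ _)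
    have hd : ∀ x, HasDerivAt (iteratedDeriv (m + 1) f) (iteratedDeriv (m + 1 + 1) f x) x :=
      fun x => by
        rw [iteratedDeriv_succ (n := m + 1)]
        exact (hf.differentiable_iteratedDeriv (m + 1) (by exact_mod_cast Nat.lt_succ_self _)
          x).hasDerivAt
    have key := OneDim.mul_inner_shiftInverse hd (OneDim.memLp_iteratedDeriv hf' hc)
      (OneDim.memLp_iteratedDeriv hf hc) (c := (m : ℝ) + 1) (by positivity) (hR m)
      (R' := R (m + 1)) (by simpa using hR (m + 1))
    rw [ih f hf' hc]
    simp only [Nat.add_sub_cancel]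
    rw [Finset.sum_Icc_succ_top (by omega), add_assoc, Nat.add_sub_cancel]
    congr 1
    -- With $c=m+1$, dividing by $c$ turns the factor $1/m!$ into $1/(m+1)!$, and the minus sign in
    -- `key` produces the alternation.
    rw [eq_sub_iff_add_eq] at key
    rw [← key, Nat.factorial_succ]
    have h1 : (m.factorial : ℝ) ≠ 0 := by positivity
    have h2 : (m : ℝ) + 1 ≠ 0 := by positivity
    push_cast
    field_simp
    ring
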